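/- Let $X$ be an Archimedean (real) vector lattice with the $\sigma$-PP property, i.e. every band of $X$ generated by a countable set is a projection band. Let $X^\delta$ be the order (Dedekind) completion of $X$, and regard $X$ as a sublattice of $X^\delta$. A net $(x_\alpha)$ in $X^\delta$ converges uniformly to $x\in X^\delta$ if there is $e\in X^\delta$, $e\ge 0$, such that for every $\varepsilon>0$ there is $\alpha_0$ with $|x_\alpha-x|\le\varepsilon e$ for all $\alpha\ge\alpha_0$. The uniform adherence of $X$ in $X^\delta$ is the set of all limits of uniformly convergent nets (equivalently, sequences) of elements of $X$. A subset of $X^\delta$ is uniformly closed if it contains the limits of all uniformly convergent nets (equivalently, sequences) of its elements, and the uniform closure of $X$ in $X^\delta$ is the intersection of all uniformly closed subsets of $X^\delta$ containing $X$. A vector lattice is countably order complete if every non-empty countable subset that is bounded above has a supremum. Then the uniform adherence of $X$ in $X^\delta$ equals the uniform closure of $X$ in $X^\delta$. Moreover, this set is the least countably order complete (vector) sublattice of $X^\delta$ containing $X$: it is a countably order complete sublattice of $X^\delta$ containing $X$, and it is contained in every other such sublattice. -/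

import Mathlib

open scoped NNReal

/-! ### Vector lattices

A real vector lattice is a type `E` with `[AddCommGroup E] [Lattice E] [IsOrderedAddMonoid E]
[Module ℝ E] [IsOrderedModule ℝ E]`; the absolute value is `|x| = x ⊔ -x`. -/

/-- The Archimedean property of vector lattices: if `n • x ≤ y` for all `n`, then `x ≤ 0`.
(Mathlib's `Archimedean` is a different notion, meant for linear orders.) -/
class IsArchimedeanVectorLattice (E : Type*) [AddCommGroup E] [PartialOrder E] : Prop where
  nonpos_of_forall_nsmul_le : ∀ x y : E, (∀ n : ℕ, n • x ≤ y) → x ≤ 0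

section VectorLattice

variable {E : Type*} [AddCommGroup E] [Lattice E] [Module ℝ E]

/-- A (vector) sublattice: a linear subspace closed under the lattice operations. -/
structure IsVectorSublattice (Y : Set E) : Prop where
  zero_mem : (0 : E) ∈ Y
  add_mem : ∀ ⦃x y : E⦄, x ∈ Y → y ∈ Y → x + y ∈ Y
  smul_mem : ∀ (r : ℝ) ⦃x : E⦄, x ∈ Y → r • x ∈ Y
  sup_mem : ∀ ⦃x y : E⦄, x ∈ Y → y ∈ Y → x ⊔ y ∈ Y
  inf_mem : ∀ ⦃x y : E⦄, x ∈ Y → y ∈ Y → x ⊓ y ∈ Y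

/-- An (order) ideal: a solid linear subspace. -/
structure IsLatticeIdeal (J : Set E) : Prop where
  zero_mem : (0 : E) ∈ J
  add_mem : ∀ ⦃x y : E⦄, x ∈ J → y ∈ J → x + y ∈ J
  smul_mem : ∀ (r : ℝ) ⦃x : E⦄, x ∈ J → r • x ∈ J
  solid : ∀ ⦃x y : E⦄, |x| ≤ |y| → y ∈ J → x ∈ J

/-- A band: an ideal closed under all suprema of its subsets that exist in the whole space. -/
structure IsBand (B : Set E) : Prop extends IsLatticeIdeal B where
  isLUB_mem : ∀ (D : Set E) (x : E), D ⊆ B → D.Nonempty → IsLUB D x → x ∈ B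

/-- The band generated by a set: the intersection of all bands containing it. -/
def generatedBand (A : Set E) : Set E :=
  ⋂₀ {B : Set E | IsBand B ∧ A ⊆ B}

/-- A projection band: a band `B` such that `E = B + Bᵈ`, where
`Bᵈ = {z | |z| ⊓ |b| = 0 for all b ∈ B}` is the disjoint complement of `B`. -/
def IsProjectionBand (B : Set E) : Prop :=
  IsBand B ∧ ∀ x : E, ∃ y z : E, y ∈ B ∧ (∀ b ∈ B, |z| ⊓ |b| = 0) ∧ x = y + z

variable (E) in
/-- The `σ`-PP property: every band generated by a countable set is a projection band. -/
def HasSigmaPP : Prop :=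
  ∀ A : Set E, A.Countable → IsProjectionBand (generatedBand A)

/-- The net `x` converges to `a` uniformly relative to `e`. -/
def ConvergesUniformlyRel {ι : Type*} [Preorder ι] (e : E) (x : ι → E) (a : E) : Prop :=
  ∀ ε : ℝ, 0 < ε → ∃ i₀ : ι, ∀ i ≥ i₀, |x i - a| ≤ ε • e

/-- (Relatively) uniform convergence in `E`: convergence relative to some regulator `e ∈ E₊`. -/
def ConvergesUniformly {ι : Type*} [Preorder ι] (x : ι → E) (a : E) : Prop :=
  ∃ e : E, 0 ≤ e ∧ ConvergesUniformlyRel e x a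

/-- The uniform adherence of `A` in `E`: all uniform limits in `E` of sequences in `A`.
Nets give the same set, see `mem_uniformAdherence_of_net`. -/
def uniformAdherence (A : Set E) : Set E :=
  {a : E | ∃ x : ℕ → E, (∀ n, x n ∈ A) ∧ ConvergesUniformly x a}

theorem mem_uniformAdherence_of_net [IsOrderedModule ℝ E] {ι : Type*} [Preorder ι] {A : Set E}
    {x : ι → E} {a : E} (hx : ∀ i, x i ∈ A) (h : ConvergesUniformly x a) :
    a ∈ uniformAdherence A := by
  obtain ⟨e, he, h⟩ := h
  choose i hi using fun n : ℕ => h (1 / ((n : ℝ) + 1)) (by positivity)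
  refine ⟨fun n => x (i n), fun n => hx _, e, he, fun ε hε => ?_⟩
  obtain ⟨N, hN⟩ := exists_nat_one_div_lt hε
  refine ⟨N, fun n hn => (hi n _ le_rfl).trans (smul_le_smul_of_nonneg_right ?_ he)⟩
  exact (one_div_le_one_div_of_le (by positivity) (by exact_mod_cast Nat.succ_le_succ hn)).trans hN.le

/-- `C` is uniformly closed if it contains the uniform limits of all sequences in `C`. -/
def IsUniformlyClosed (C : Set E) : Prop :=
  ∀ (x : ℕ → E) (a : E), (∀ n, x n ∈ C) → ConvergesUniformly x a → a ∈ C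

/-- The uniform closure of `A` in `E`: the intersection of all uniformly closed sets
containing `A`. -/
def uniformClosure (A : Set E) : Set E :=
  ⋂₀ {C : Set E | IsUniformlyClosed C ∧ A ⊆ C}

end VectorLattice

/-- Countable order completeness: every non-empty countable set which is bounded above has a
supremum. For a sublattice `Y` this is applied to `Y` with the induced order, so that bounds and
suprema are taken in `Y`. -/
def IsCountablyOrderComplete (P : Type*) [Preorder P] : Prop :=
  ∀ s : Set P, s.Countable → s.Nonempty → BddAbove s → ∃ a : P, IsLUB s a

/-! ### The order completion of a vector lattice -/

/-- The order (Dedekind) completion of `X`: the Dedekind cuts of `X` both of whose sides are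
non-empty, ordered by inclusion of the left sides. -/
def OrderCompletion (X : Type*) [Preorder X] : Type _ :=
  {A : DedekindCut X // A.left.Nonempty ∧ A.right.Nonempty}

namespace OrderCompletion

section Order

variable {X : Type*} [Lattice X]

instance : Lattice (OrderCompletion X) :=
  Subtype.lattice
    (fun {A B} hA hB => by
      obtain ⟨a, ha⟩ := hA.1
      obtain ⟨c, hc⟩ := hA.2
      obtain ⟨d, hd⟩ := hB.2
      refine ⟨⟨a, (le_sup_left : A ≤ A ⊔ B) ha⟩, c ⊔ d, ?_, ?_⟩
      · exact A.mem_intent_of_intent_rel le_sup_left hc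
      · exact B.mem_intent_of_intent_rel le_sup_right hd)
    (fun {A B} hA hB => by
      obtain ⟨a, ha⟩ := hA.1
      obtain ⟨b, hb⟩ := hB.1
      obtain ⟨c, hc⟩ := hA.2
      refine ⟨⟨a ⊓ b, ?_, ?_⟩, c, ?_⟩
      · exact A.mem_extent_of_rel_extent inf_le_left ha
      · exact B.mem_extent_of_rel_extent inf_le_right hb
      · exact Concept.intent_subset_intent_iff.2 (inf_le_left : A ⊓ B ≤ A) hc)

/-- The canonical embedding of `X` into its order completion. -/
def of (x : X) : OrderCompletion X :=
  ⟨DedekindCut.principal x, ⟨x, le_rfl⟩, ⟨x, le_rfl⟩⟩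

/-- The least cut whose left side contains `S`; it is the supremum of the image of `S`. -/
def gen (S : Set X) (hne : S.Nonempty) (hb : BddAbove S) : OrderCompletion X :=
  ⟨Concept.ofObjects (· ≤ ·) S,
    hne.mono (Concept.ofObjects_le_iff.1 le_rfl), hb⟩

theorem mem_right_gen {S : Set X} {hne : S.Nonempty} {hb : BddAbove S} {c : X} :
    c ∈ (gen S hne hb).1.right ↔ ∀ s ∈ S, s ≤ c := Iff.rfl

theorem mem_right_of {x c : X} : c ∈ (of x).1.right ↔ x ≤ c := Iff.rfl

theorem mem_left_of {x c : X} : c ∈ (of x).1.left ↔ c ≤ x := Iff.rfl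

theorem mem_right_iff {A : OrderCompletion X} {c : X} :
    c ∈ A.1.right ↔ ∀ a ∈ A.1.left, a ≤ c := by
  rw [← DedekindCut.upperBounds_left]; rfl

theorem mem_left_iff {A : OrderCompletion X} {a : X} :
    a ∈ A.1.left ↔ ∀ c ∈ A.1.right, a ≤ c := by
  rw [← DedekindCut.lowerBounds_right]; rfl

theorem le_iff {A B : OrderCompletion X} : A ≤ B ↔ ∀ c ∈ B.1.right, c ∈ A.1.right :=
  (Concept.intent_subset_intent_iff (c := B.1) (d := A.1)).symm

theorem ext_right {A B : OrderCompletion X} (h : ∀ c, c ∈ A.1.right ↔ c ∈ B.1.right) : A = B :=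
  Subtype.ext (DedekindCut.ext' (Set.ext h))

theorem of_le_of {x y : X} : of x ≤ of y ↔ x ≤ y := DedekindCut.principal_le_principal

theorem of_le_iff {x : X} {A : OrderCompletion X} : of x ≤ A ↔ x ∈ A.1.left :=
  DedekindCut.principal_le_iff

theorem le_of_iff {x : X} {A : OrderCompletion X} : A ≤ of x ↔ x ∈ A.1.right :=
  DedekindCut.le_principal_iff

/-- `X` is majorizing in its order completion. -/
theorem exists_le_of (A : OrderCompletion X) : ∃ x : X, A ≤ of x :=
  A.2.2.imp fun _ => le_of_iff.2

/-- Every element of the completion is the supremum of the elements of `X` below it. -/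
theorem isLUB_of (A : OrderCompletion X) : IsLUB (of '' {x : X | of x ≤ A}) A := by
  refine ⟨by rintro _ ⟨x, hx, rfl⟩; exact hx, fun B hB => ?_⟩
  refine le_iff.2 fun c hc => mem_right_iff.2 fun a ha => ?_
  have h := hB ⟨a, of_le_iff.2 ha, rfl⟩
  exact mem_left_iff.1 (of_le_iff.1 h) c hc

/-- The order completion is order complete. -/
theorem exists_isLUB (s : Set (OrderCompletion X)) (hne : s.Nonempty) (hb : BddAbove s) :
    ∃ A, IsLUB s A := by
  obtain ⟨B, hB⟩ := hb
  obtain ⟨A₀, hA₀⟩ := hne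
  obtain ⟨a, ha⟩ := A₀.2.1
  obtain ⟨b, hb⟩ := B.2.2
  refine ⟨gen {x | ∃ A ∈ s, x ∈ A.1.left} ⟨a, A₀, hA₀, ha⟩ ⟨b, ?_⟩, fun A hA => ?_, fun C hC => ?_⟩
  · rintro x ⟨A, hA, hx⟩
    exact mem_right_iff.1 (le_iff.1 (hB hA) b hb) x hx
  · exact le_iff.2 fun c hc => mem_right_iff.2 fun x hx => hc ⟨A, hA, hx⟩
  · refine le_iff.2 fun c hc => mem_right_gen.2 ?_
    rintro x ⟨A, hA, hx⟩
    exact mem_right_iff.1 (le_iff.1 (hC hA) c hc) x hx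

theorem of_sup (x y : X) : of (x ⊔ y) = of x ⊔ of y := by
  refine le_antisymm (le_iff.2 fun c hc => ?_) (sup_le ?_ ?_)
  · exact sup_le (le_iff.1 (le_sup_left : of x ≤ of x ⊔ of y) c hc)
      (le_iff.1 (le_sup_right : of y ≤ of x ⊔ of y) c hc)
  · exact of_le_of.2 le_sup_left
  · exact of_le_of.2 le_sup_right

theorem of_inf (x y : X) : of (x ⊓ y) = of x ⊓ of y := by
  refine le_antisymm (le_inf (of_le_of.2 inf_le_left) (of_le_of.2 inf_le_right)) ?_
  refine (isLUB_le_iff (isLUB_of _)).2 ?_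
  rintro _ ⟨z, hz, rfl⟩
  have hz : of z ≤ of x ⊓ of y := hz
  exact of_le_of.2 (le_inf (of_le_of.1 (hz.trans inf_le_left)) (of_le_of.1 (hz.trans inf_le_right)))

end Order

section Group

variable {X : Type*} [AddCommGroup X] [Lattice X] [IsOrderedAddMonoid X]

instance : Zero (OrderCompletion X) := ⟨of 0⟩

/-- `A + B = sup {a + b | a ∈ X, b ∈ X, a ≤ A, b ≤ B}`. -/
instance : Add (OrderCompletion X) where
  add A B := gen {x | ∃ a ∈ A.1.left, ∃ b ∈ B.1.left, x = a + b}
    (by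
      obtain ⟨a, ha⟩ := A.2.1
      obtain ⟨b, hb⟩ := B.2.1
      exact ⟨a + b, a, ha, b, hb, rfl⟩)
    (by
      obtain ⟨a, ha⟩ := A.2.2
      obtain ⟨b, hb⟩ := B.2.2
      refine ⟨a + b, ?_⟩
      rintro _ ⟨x, hx, y, hy, rfl⟩
      exact add_le_add (mem_right_iff.1 ha x hx) (mem_right_iff.1 hb y hy))

/-- `-A = sup {-c | c ∈ X, A ≤ c}`. -/
instance : Neg (OrderCompletion X) where
  neg A := gen {x | -x ∈ A.1.right}
    (by
      obtain ⟨a, ha⟩ := A.2.2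
      exact ⟨-a, by simpa using ha⟩)
    (by
      obtain ⟨a, ha⟩ := A.2.1
      exact ⟨-a, fun x hx => le_neg.1 (mem_right_iff.1 hx a ha)⟩)

theorem mem_right_add {A B : OrderCompletion X} {c : X} :
    c ∈ (A + B).1.right ↔ ∀ a ∈ A.1.left, ∀ b ∈ B.1.left, a + b ≤ c := by
  refine mem_right_gen.trans ⟨fun h a ha b hb => h _ ⟨a, ha, b, hb, rfl⟩, ?_⟩
  rintro h _ ⟨a, ha, b, hb, rfl⟩
  exact h a ha b hb

theorem mem_right_neg {A : OrderCompletion X} {c : X} :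
    c ∈ (-A).1.right ↔ -c ∈ A.1.left := by
  rw [mem_left_iff]
  refine mem_right_gen.trans ⟨fun h d hd => ?_, fun h s hs => ?_⟩
  · exact neg_le.1 (h (-d) (by simpa using hd))
  · simpa using h (-s) hs

theorem add_comm_aux (A B : OrderCompletion X) : A + B = B + A := by
  refine ext_right fun c => ?_
  simp only [mem_right_add]
  constructor <;> intro h a ha b hb <;> rw [add_comm] <;> exact h b hb a ha

theorem add_assoc_aux (A B C : OrderCompletion X) : A + B + C = A + (B + C) := by
  refine ext_right fun c => ?_
  have h1 : c ∈ (A + B + C).1.right ↔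
      ∀ a ∈ A.1.left, ∀ b ∈ B.1.left, ∀ d ∈ C.1.left, a + b + d ≤ c := by
    rw [mem_right_add]
    constructor
    · intro h a ha b hb d hd
      have : c - d ∈ (A + B).1.right :=
        mem_right_iff.2 fun x hx => le_sub_iff_add_le.2 (h x hx d hd)
      exact le_sub_iff_add_le.1 (mem_right_add.1 this a ha b hb)
    · intro h x hx d hd
      have : c - d ∈ (A + B).1.right :=
        mem_right_add.2 fun a ha b hb => le_sub_iff_add_le.2 (h a ha b hb d hd)
      exact le_sub_iff_add_le.1 (mem_right_iff.1 this x hx)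
  have h2 : c ∈ (A + (B + C)).1.right ↔
      ∀ a ∈ A.1.left, ∀ b ∈ B.1.left, ∀ d ∈ C.1.left, a + b + d ≤ c := by
    rw [mem_right_add]
    constructor
    · intro h a ha b hb d hd
      have : c - a ∈ (B + C).1.right :=
        mem_right_iff.2 fun x hx => le_sub_iff_add_le'.2 (h a ha x hx)
      rw [add_assoc]
      exact le_sub_iff_add_le'.1 (mem_right_add.1 this b hb d hd)
    · intro h a ha x hx
      have : c - a ∈ (B + C).1.right :=
        mem_right_add.2 fun b hb d hd => le_sub_iff_add_le'.2 (by
          rw [← add_assoc]; exact h a ha b hb d hd)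
      exact le_sub_iff_add_le'.1 (mem_right_iff.1 this x hx)
  rw [h1, h2]

theorem zero_add_aux (A : OrderCompletion X) : 0 + A = A := by
  refine ext_right fun c => ?_
  rw [mem_right_add, mem_right_iff]
  constructor
  · intro h a ha
    simpa using h 0 (mem_left_of.2 le_rfl) a ha
  · intro h z hz a ha
    have hz : z ≤ 0 := hz
    simpa using add_le_add hz (h a ha)

theorem of_add (x y : X) : of (x + y) = of x + of y := by
  refine ext_right fun c => ?_
  rw [mem_right_add, mem_right_of]
  exact ⟨fun h a ha b hb => (add_le_add ha hb).trans h, fun h => h x le_rfl y le_rfl⟩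

variable [IsArchimedeanVectorLattice X]

theorem neg_add_aux (A : OrderCompletion X) : -A + A = 0 := by
  rw [add_comm_aux]
  refine ext_right fun c => ?_
  have hz : c ∈ (0 : OrderCompletion X).1.right ↔ 0 ≤ c := Iff.rfl
  have hn : ∀ b, b ∈ (-A).1.left ↔ -b ∈ A.1.right := by
    intro b
    rw [mem_left_iff, mem_right_iff]
    constructor
    · intro h a ha
      exact le_neg.1 (h (-a) (mem_right_neg.2 (by simpa using ha)))
    · intro h d hd
      simpa using neg_le.1 (neg_le_neg (h _ (mem_right_neg.1 hd)))
  rw [hz, mem_right_add]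
  constructor
  · intro h
    have step : ∀ d ∈ A.1.right, d + c ∈ A.1.right := fun d hd => mem_right_iff.2 fun a ha => by
      have := h a ha (-d) ((hn _).2 (by simpa using hd))
      rw [← sub_eq_add_neg] at this
      exact sub_le_iff_le_add'.1 this
    obtain ⟨a, ha⟩ := A.2.1
    obtain ⟨d, hd⟩ := A.2.2
    have hall : ∀ n : ℕ, d + n • c ∈ A.1.right := by
      intro n
      induction n with
      | zero => simpa using hd
      | succ n ih => rw [succ_nsmul, ← add_assoc]; exact step _ ih
    have : -c ≤ 0 := IsArchimedeanVectorLattice.nonpos_of_forall_nsmul_le (-c) (d - a) fun n => by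
      have := mem_right_iff.1 (hall n) a ha
      rw [smul_neg, neg_le_sub_iff_le_add']
      rwa [add_comm]
    exact neg_nonpos.1 this
  · intro hc a ha b hb
    have := mem_right_iff.1 ((hn b).1 hb) a ha
    have h2 : a + b ≤ 0 := by simpa using add_le_add_left this b
    exact h2.trans hc

instance : AddCommGroup (OrderCompletion X) where
  add_assoc := add_assoc_aux
  zero_add := zero_add_aux
  add_zero A := by rw [add_comm_aux, zero_add_aux]
  neg_add_cancel := neg_add_aux
  add_comm := add_comm_aux
  nsmul := nsmulRec
  zsmul := zsmulRec

instance : IsOrderedAddMonoid (OrderCompletion X) where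
  add_le_add_left _ _ h _ := le_iff.2 fun _ hc => mem_right_add.2 fun a ha b hb =>
    mem_right_add.1 hc a (Concept.extent_subset_extent_iff.2 h ha) b hb

end Group

section Module

variable {X : Type*} [AddCommGroup X] [Lattice X] [IsOrderedAddMonoid X]
  [Module ℝ X] [IsOrderedModule ℝ X]

/-- Multiplication by a non-negative scalar: `r A = sup {r a | a ∈ X, a ≤ A}`. -/
def nnsmul (r : ℝ≥0) (A : OrderCompletion X) : OrderCompletion X :=
  gen {x | ∃ a ∈ A.1.left, x = (r : ℝ) • a}
    (by
      obtain ⟨a, ha⟩ := A.2.1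
      exact ⟨_, a, ha, rfl⟩)
    (by
      obtain ⟨c, hc⟩ := A.2.2
      refine ⟨(r : ℝ) • c, ?_⟩
      rintro _ ⟨a, ha, rfl⟩
      exact smul_le_smul_of_nonneg_left (mem_right_iff.1 hc a ha) r.2)

theorem mem_right_nnsmul {r : ℝ≥0} {A : OrderCompletion X} {c : X} :
    c ∈ (nnsmul r A).1.right ↔ ∀ a ∈ A.1.left, (r : ℝ) • a ≤ c := by
  refine mem_right_gen.trans ⟨fun h a ha => h _ ⟨a, ha, rfl⟩, ?_⟩
  rintro h _ ⟨a, ha, rfl⟩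
  exact h a ha

theorem nnsmul_zero_left (A : OrderCompletion X) : nnsmul 0 A = 0 := by
  refine ext_right fun c => ?_
  rw [mem_right_nnsmul]
  have hz : c ∈ (0 : OrderCompletion X).1.right ↔ 0 ≤ c := Iff.rfl
  obtain ⟨a, ha⟩ := A.2.1
  rw [hz]
  simp only [NNReal.coe_zero, zero_smul]
  exact ⟨fun h => h a ha, fun h _ _ => h⟩

theorem nnsmul_one (A : OrderCompletion X) : nnsmul 1 A = A := by
  refine ext_right fun c => ?_
  rw [mem_right_nnsmul, mem_right_iff]
  simp

theorem mem_right_nnsmul_of_pos {r : ℝ≥0} (hr : 0 < r) {A : OrderCompletion X} {c : X} :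
    c ∈ (nnsmul r A).1.right ↔ (r : ℝ)⁻¹ • c ∈ A.1.right := by
  rw [mem_right_nnsmul, mem_right_iff]
  have hr' : (0 : ℝ) < r := hr
  exact forall₂_congr fun a _ => (le_inv_smul_iff_of_pos hr').symm

theorem nnsmul_mul (r s : ℝ≥0) (A : OrderCompletion X) :
    nnsmul (r * s) A = nnsmul r (nnsmul s A) := by
  rcases eq_or_lt_of_le (zero_le (a := r)) with rfl | hr
  · rw [zero_mul, nnsmul_zero_left, nnsmul_zero_left]
  refine ext_right fun c => ?_
  have hr' : (0 : ℝ) < r := hr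
  rw [mem_right_nnsmul_of_pos hr, mem_right_nnsmul, mem_right_nnsmul]
  refine forall₂_congr fun a _ => ?_
  rw [le_inv_smul_iff_of_pos hr', NNReal.coe_mul, mul_smul]

theorem nnsmul_add_left (r s : ℝ≥0) (A : OrderCompletion X) :
    nnsmul (r + s) A = nnsmul r A + nnsmul s A := by
  refine le_antisymm (le_iff.2 fun c hc => mem_right_nnsmul.2 fun a ha => ?_)
    (le_iff.2 fun c hc => mem_right_add.2 fun x hx y hy => ?_)
  · rw [NNReal.coe_add, add_smul]
    exact mem_right_add.1 hc _ (mem_left_iff.2 fun d hd => mem_right_nnsmul.1 hd a ha) _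
      (mem_left_iff.2 fun d hd => mem_right_nnsmul.1 hd a ha)
  · have key : ∀ a ∈ A.1.left, ∀ b ∈ A.1.left, (r : ℝ) • a + (s : ℝ) • b ≤ c := by
      intro a ha b hb
      have hab : a ⊔ b ∈ A.1.left :=
        mem_left_iff.2 fun d hd => sup_le (mem_left_iff.1 ha d hd) (mem_left_iff.1 hb d hd)
      have h := mem_right_nnsmul.1 hc _ hab
      rw [NNReal.coe_add, add_smul] at h
      exact (add_le_add (smul_le_smul_of_nonneg_left le_sup_left r.2)
        (smul_le_smul_of_nonneg_left le_sup_right s.2)).trans h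
    have h1 : ∀ b ∈ A.1.left, x ≤ c - (s : ℝ) • b := fun b hb =>
      mem_left_iff.1 hx _ (mem_right_nnsmul.2 fun a ha => le_sub_iff_add_le.2 (key a ha b hb))
    exact le_sub_iff_add_le'.1 (mem_left_iff.1 hy _ (mem_right_nnsmul.2 fun b hb =>
      le_sub_comm.1 (h1 b hb)))

variable [IsArchimedeanVectorLattice X]

theorem nnsmul_add_right (r : ℝ≥0) (A B : OrderCompletion X) :
    nnsmul r (A + B) = nnsmul r A + nnsmul r B := by
  rcases eq_or_lt_of_le (zero_le (a := r)) with rfl | hr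
  · simp only [nnsmul_zero_left, add_zero]
  have hr' : (0 : ℝ) < r := hr
  have hl : ∀ (C : OrderCompletion X) (x : X), x ∈ (nnsmul r C).1.left ↔ (r : ℝ)⁻¹ • x ∈ C.1.left := by
    intro C x
    rw [mem_left_iff, mem_left_iff]
    refine ⟨fun h c hc => ?_, fun h c hc => ?_⟩
    · rw [inv_smul_le_iff_of_pos hr']
      exact h _ ((mem_right_nnsmul_of_pos hr).2 (by rwa [inv_smul_smul₀ hr'.ne']))
    · have := h _ ((mem_right_nnsmul_of_pos hr).1 hc)
      rwa [inv_smul_le_iff_of_pos hr', smul_inv_smul₀ hr'.ne'] at this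
  refine ext_right fun c => ?_
  rw [mem_right_nnsmul_of_pos hr, mem_right_add, mem_right_add]
  constructor
  · intro h a ha b hb
    have := h _ ((hl _ _).1 ha) _ ((hl _ _).1 hb)
    rwa [← smul_add, inv_smul_le_iff_of_pos hr', smul_inv_smul₀ hr'.ne'] at this
  · intro h a ha b hb
    rw [le_inv_smul_iff_of_pos hr', smul_add]
    exact h _ ((hl _ _).2 (by rwa [inv_smul_smul₀ hr'.ne'])) _
      ((hl _ _).2 (by rwa [inv_smul_smul₀ hr'.ne']))

theorem toNNReal_sub_toNNReal_neg (r : ℝ) : (r.toNNReal : ℝ) - ((-r).toNNReal : ℝ) = r := by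
  rw [Real.coe_toNNReal', Real.coe_toNNReal']
  exact posPart_sub_negPart r

/-- `r A = r⁺ A - r⁻ A`. -/
instance : SMul ℝ (OrderCompletion X) where
  smul r A := nnsmul r.toNNReal A - nnsmul (-r).toNNReal A

theorem smul_eq {r : ℝ} {p q : ℝ≥0} (h : r = p - q) (A : OrderCompletion X) :
    r • A = nnsmul p A - nnsmul q A := by
  change nnsmul r.toNNReal A - nnsmul (-r).toNNReal A = _
  rw [sub_eq_sub_iff_add_eq_add, ← nnsmul_add_left, ← nnsmul_add_left]
  congr 1
  apply NNReal.coe_injective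
  have := toNNReal_sub_toNNReal_neg r
  push_cast
  linarith

theorem exists_sub (r : ℝ) : ∃ p q : ℝ≥0, r = p - q :=
  ⟨r.toNNReal, (-r).toNNReal, (toNNReal_sub_toNNReal_neg r).symm⟩

instance : Module ℝ (OrderCompletion X) where
  one_smul A := by
    rw [smul_eq (p := 1) (q := 0) (by simp), nnsmul_one, nnsmul_zero_left, sub_zero]
  mul_smul r s A := by
    obtain ⟨p, q, hr⟩ := exists_sub r
    obtain ⟨p', q', hs⟩ := exists_sub s
    have hsub : ∀ (t : ℝ≥0) (B C : OrderCompletion X),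
        nnsmul t (B - C) = nnsmul t B - nnsmul t C := fun t B C => by
      rw [eq_sub_iff_add_eq, ← nnsmul_add_right, sub_add_cancel]
    rw [smul_eq (p := p * p' + q * q') (q := p * q' + q * p') (by subst hr hs; push_cast; ring),
      smul_eq hs, smul_eq hr, hsub, hsub]
    simp only [nnsmul_add_left, nnsmul_mul]
    abel
  smul_zero r := by
    obtain ⟨p, q, hr⟩ := exists_sub r
    have h0 : ∀ t : ℝ≥0, nnsmul t (0 : OrderCompletion X) = 0 := fun t => by
      have := nnsmul_add_right t (0 : OrderCompletion X) 0
      simpa using this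
    rw [smul_eq hr, h0, h0, sub_zero]
  smul_add r A B := by
    obtain ⟨p, q, hr⟩ := exists_sub r
    rw [smul_eq hr, smul_eq hr, smul_eq hr, nnsmul_add_right, nnsmul_add_right]
    abel
  add_smul r s A := by
    obtain ⟨p, q, hr⟩ := exists_sub r
    obtain ⟨p', q', hs⟩ := exists_sub s
    rw [smul_eq (p := p + p') (q := q + q') (by subst hr hs; push_cast; ring),
      smul_eq hr, smul_eq hs, nnsmul_add_left, nnsmul_add_left]
    abel
  zero_smul A := by
    rw [smul_eq (p := 0) (q := 0) (by simp), sub_self]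

theorem smul_of_nonneg (r : ℝ≥0) (A : OrderCompletion X) : (r : ℝ) • A = nnsmul r A := by
  rw [smul_eq (p := r) (q := 0) (by simp), nnsmul_zero_left, sub_zero]

instance : IsOrderedModule ℝ (OrderCompletion X) :=
  have hpos : ∀ (r : ℝ) (A : OrderCompletion X), 0 ≤ r → 0 ≤ A → 0 ≤ r • A := by
    intro r A hr hA
    lift r to ℝ≥0 using hr
    rw [smul_of_nonneg]
    refine le_iff.2 fun c hc => ?_
    have h0 : (0 : X) ∈ A.1.left := of_le_iff.1 hA
    have h : (0 : X) ≤ c := by simpa using mem_right_nnsmul.1 hc 0 h0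
    exact mem_right_of.2 h
  { smul_le_smul_of_nonneg_left := fun r hr A B h => by
      have := hpos r (B - A) hr (sub_nonneg.2 h)
      rwa [smul_sub, sub_nonneg] at this
    smul_le_smul_of_nonneg_right := fun A hA r s h => by
      have := hpos (s - r) A (sub_nonneg.2 h) hA
      rwa [sub_smul, sub_nonneg] at this }

theorem of_smul (r : ℝ) (x : X) : of (r • x) = r • of x := by
  have hnn : ∀ t : ℝ≥0, of ((t : ℝ) • x) = nnsmul t (of x) := fun t => by
    refine ext_right fun c => ?_
    rw [mem_right_nnsmul, mem_right_of]
    exact ⟨fun h a ha => (smul_le_smul_of_nonneg_left ha t.2).trans h, fun h => h x le_rfl⟩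
  obtain ⟨p, q, hr⟩ := exists_sub r
  rw [smul_eq hr, eq_sub_iff_add_eq, ← hnn, ← hnn, ← of_add, ← add_smul, hr, sub_add_cancel]

end Module

end OrderCompletion

/-! Two facts carry the theorem. First, every countably order complete sublattice containing $X$ is
uniformly closed (`isUniformlyClosed_of_isCountablyOrderComplete`): after passing to indices $i_n$
with $|x_{i_n}-a|\le u/(n+1)$, the limit $a$ is squeezed between the shifted sequences $x_{i_n}\mp
u/(n+1)$, and the regulator $u$ may be taken in $X$. Secondly, the uniform adherence is itself such
a sublattice. It is therefore uniformly closed, hence equal to the closure, and every competitor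
contains it.

The hard part is countable order completeness of the adherence. Its elements are suprema of
sequences in $X$, so a countable supremum of them is again the supremum $s$ of a sequence $(x_n)$ in
$X$, and it remains to approximate $s$ uniformly from $X$. This is a Freudenthal-type argument
(`exists_approx_of_isLUB`). Suppose $0\le x_n\le s\le u$, put $t=1/(m+1)$ and $h=tu$, and let
$c_j\in X$ be the component of $u$ in the band generated by all $(x_n-(j+1)h)^+$; it exists by the
$\sigma$-PP property. Then $y=\sum_{j<m}t\,c_j$ satisfies $y\le s\le y+h$: cut each element into
layers of height $h$. The piece of $x_n$ in layer $j+1$ lies below $t\,c_j$, and $t\,c_j$ lies below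
the piece of $s$ in layer $j$. -/

section LatticeOrderedGroup

variable {E : Type*} [AddCommGroup E] [Lattice E] [IsOrderedAddMonoid E]

/-! ### Truncations and layers in lattice-ordered groups. -/

theorem inf_add_le_inf_add_inf {a b c : E} (ha : 0 ≤ a) (hb : 0 ≤ b) (hc : 0 ≤ c) :
    a ⊓ (b + c) ≤ a ⊓ b + a ⊓ c := by
  rw [add_inf, inf_add, inf_add]
  refine le_inf (le_inf ?_ ?_) (le_inf ?_ inf_le_right)
  · exact inf_le_left.trans (le_add_of_nonneg_left ha)
  · exact inf_le_left.trans (le_add_of_nonneg_left hb)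
  · exact inf_le_left.trans (le_add_of_nonneg_right hc)

theorem inf_eq_zero_of_le {a b c d : E} (ha : 0 ≤ a) (hb : 0 ≤ b) (hac : a ≤ c) (hbd : b ≤ d)
    (h : c ⊓ d = 0) : a ⊓ b = 0 :=
  le_antisymm ((inf_le_inf hac hbd).trans h.le) (le_inf ha hb)

theorem sup_zero_inf_neg_sup_zero (a : E) : (a ⊔ 0) ⊓ (-a ⊔ 0) = 0 :=
  posPart_inf_negPart_eq_zero a

/-- Raising the truncation level from $a$ to $a+h$ adds exactly one layer. After translation by $a$
this is the decomposition $w=w\wedge 0+w\vee 0$, truncated at $h$. -/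
theorem inf_add_eq_inf_add_sub_inf (s a : E) {h : E} (hh : 0 ≤ h) :
    s ⊓ (a + h) = s ⊓ a + ((s - a) ⊔ 0) ⊓ h := by
  have key : ∀ w : E, w ⊓ h = w ⊓ 0 + (w ⊔ 0) ⊓ h := fun w => by
    rw [add_inf, inf_add_sup, add_zero, inf_add, zero_add, ← inf_assoc,
      inf_eq_left.2 (le_add_of_nonneg_right hh)]
  have h1 : s ⊓ (a + h) = a + (s - a) ⊓ h := by rw [add_inf, add_sub_cancel]
  have h2 : s ⊓ a = a + (s - a) ⊓ 0 := by rw [add_inf, add_sub_cancel, add_zero]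
  rw [h1, h2, key, add_assoc]

/-- Layer-by-layer lower bound; with `inf_nsmul_le_add_sum` it gives the two halves of the
approximation. -/
theorem sum_le_inf_nsmul {s h : E} (hs : 0 ≤ s) (hh : 0 ≤ h) {d : ℕ → E}
    (hd : ∀ j : ℕ, d j ≤ ((s - j • h) ⊔ 0) ⊓ h) (k : ℕ) :
    ∑ j ∈ Finset.range k, d j ≤ s ⊓ k • h := by
  induction k with
  | zero => simpa using hs
  | succ k ih =>
    rw [Finset.sum_range_succ, succ_nsmul, inf_add_eq_inf_add_sub_inf _ _ hh]
    exact add_le_add ih (hd k)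

/-- Here `d j` bounds layer $j+1$ instead of layer $j$. The bottom layer is estimated crudely by
$h$, which is the whole error of the approximation. -/
theorem inf_nsmul_le_add_sum {x h : E} (hh : 0 ≤ h) {d : ℕ → E}
    (hd : ∀ j : ℕ, ((x - (j + 1) • h) ⊔ 0) ⊓ h ≤ d j) (k : ℕ) :
    x ⊓ (k + 1) • h ≤ h + ∑ j ∈ Finset.range k, d j := by
  induction k with
  | zero => simp
  | succ k ih =>
    rw [Finset.sum_range_succ, succ_nsmul, inf_add_eq_inf_add_sub_inf _ _ hh, ← add_assoc]
    exact add_le_add ih (hd k)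

/-! ### Disjointness, bands and components. -/

/-- Both $|b|$ and $|a|$ dominate $-a$, hence so does their infimum $0$. -/
theorem nonneg_of_add_nonneg_of_disjoint {a b : E} (h : 0 ≤ a + b) (hab : |b| ⊓ |a| = 0) :
    0 ≤ a := by
  refine neg_nonpos.1 (hab ▸ le_inf ?_ (neg_le_abs a))
  exact (neg_le_iff_add_nonneg'.2 h).trans (le_abs_self b)

variable [Module ℝ E] [IsOrderedModule ℝ E]

theorem abs_smul_le_smul_abs (r : ℝ) (x : E) : |r • x| ≤ |r| • |x| := by
  have h : ∀ (t : ℝ) (y : E), 0 ≤ t → |t • y| ≤ t • |y| := fun t y ht => by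
    refine abs_le'.2 ⟨smul_le_smul_of_nonneg_left (le_abs_self y) ht, ?_⟩
    rw [← smul_neg]
    exact smul_le_smul_of_nonneg_left (neg_le_abs y) ht
  rcases le_total 0 r with hr | hr
  · rw [abs_of_nonneg hr]
    exact h r x hr
  · have := h (-r) x (neg_nonneg.2 hr)
    rwa [neg_smul, abs_neg, ← abs_of_nonpos hr] at this

theorem isBand_disjoint {z : E} (hz : 0 ≤ z) : IsBand {y : E | |y| ⊓ z = 0} where
  zero_mem := by simpa using hz
  add_mem x y hx hy := by
    refine le_antisymm ?_ (le_inf (abs_nonneg _) hz)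
    calc |x + y| ⊓ z ≤ z ⊓ (|x| + |y|) := by
          rw [inf_comm]; exact inf_le_inf_left _ (abs_add_le x y)
      _ ≤ z ⊓ |x| + z ⊓ |y| := inf_add_le_inf_add_inf hz (abs_nonneg _) (abs_nonneg _)
      _ = 0 := by
          rw [inf_comm z, inf_comm z, show |x| ⊓ z = 0 from hx, show |y| ⊓ z = 0 from hy,
            add_zero]
  smul_mem r x hx := by
    obtain ⟨n, hn⟩ := exists_nat_ge |r|
    have h : ∀ n : ℕ, (n • |x|) ⊓ z = 0 := fun n => by
      induction n with
      | zero => simpa using hz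
      | succ n ih =>
        refine le_antisymm ?_ (le_inf (nsmul_nonneg (abs_nonneg _) _) hz)
        rw [succ_nsmul, inf_comm]
        refine (inf_add_le_inf_add_inf hz (nsmul_nonneg (abs_nonneg _) _) (abs_nonneg _)).trans ?_
        rw [inf_comm z, ih, inf_comm z, show |x| ⊓ z = 0 from hx, add_zero]
    refine inf_eq_zero_of_le (abs_nonneg _) hz ?_ le_rfl (h n)
    refine (abs_smul_le_smul_abs r x).trans ?_
    rw [← Nat.cast_smul_eq_nsmul ℝ]
    exact smul_le_smul_of_nonneg_right hn (abs_nonneg _)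
  solid x y hxy hy := inf_eq_zero_of_le (abs_nonneg _) hz hxy le_rfl hy
  isLUB_mem D x hD hne hx := by
    have hpos : (x ⊔ 0) ⊓ z = 0 := by
      have h0 : 0 ≤ (x ⊔ 0) ⊓ z := le_inf le_sup_right hz
      -- Put $p=x^+\wedge z$. For $d\in D$ the elements $d^+$ and $p$ are disjoint, so
      -- $d^++p=d^+\vee p\le x^+$. Thus $x^+-p$ still bounds $D$, which forces $p=0$.
      have hle : x ≤ (x ⊔ 0) - (x ⊔ 0) ⊓ z := hx.2 fun d hd => by
        have hdz : (d ⊔ 0) ⊓ ((x ⊔ 0) ⊓ z) = 0 :=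
          inf_eq_zero_of_le le_sup_right h0 (sup_le (le_abs_self d) (abs_nonneg d)) inf_le_right
            (hD hd)
        have hsum : (d ⊔ 0) + (x ⊔ 0) ⊓ z ≤ x ⊔ 0 := by
          rw [← inf_add_sup, hdz, zero_add]
          exact sup_le (sup_le_sup_right (hx.1 hd) 0) inf_le_left
        exact le_sup_left.trans (le_sub_iff_add_le.2 hsum)
      have h1 : x ⊔ 0 ≤ (x ⊔ 0) - (x ⊔ 0) ⊓ z := sup_le hle (sub_nonneg.2 inf_le_left)
      exact le_antisymm (by simpa using h1) h0
    obtain ⟨d, hd⟩ := hne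
    -- A single $d\in D$ suffices here: $d\le x$ gives $x^-\le d^-\le|d|$.
    have hneg : z ⊓ (-x ⊔ 0) = 0 := by
      rw [inf_comm]
      refine inf_eq_zero_of_le le_sup_right hz ?_ le_rfl (hD hd)
      exact sup_le ((neg_le_neg (hx.1 hd)).trans (neg_le_abs d)) (abs_nonneg d)
    refine le_antisymm ?_ (le_inf (abs_nonneg _) hz)
    have habs : |x| ≤ (x ⊔ 0) + (-x ⊔ 0) :=
      abs_le'.2 ⟨le_sup_left.trans (le_add_of_nonneg_right le_sup_right),
        le_sup_left.trans (le_add_of_nonneg_left le_sup_right)⟩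
    rw [inf_comm]
    refine (inf_le_inf_left z habs).trans
      ((inf_add_le_inf_add_inf hz le_sup_right le_sup_right).trans ?_)
    rw [hneg, inf_comm, hpos, add_zero]

/-- The disjoint complement of $z$ is a band containing $A$, so it contains $z$, and $z$ is disjoint
from itself. -/
theorem eq_zero_of_mem_generatedBand_of_disjoint {A : Set E} {z : E} (hz : 0 ≤ z)
    (hzA : z ∈ generatedBand A) (h : ∀ a ∈ A, |a| ⊓ z = 0) : z = 0 := by
  have : |z| ⊓ z = 0 := hzA _ ⟨isBand_disjoint hz, h⟩
  rwa [abs_of_nonneg hz, inf_idem] at this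

theorem subset_generatedBand (A : Set E) : A ⊆ generatedBand A :=
  fun _ ha _ hB => hB.2 ha

/-- The component of `u` in the band generated by a sequence of positive elements. -/
theorem HasSigmaPP.exists_component (hE : HasSigmaPP E) {g : ℕ → E} (hg : ∀ n, 0 ≤ g n) {u : E}
    (hu : 0 ≤ u) : ∃ c : E, 0 ≤ c ∧ c ≤ u ∧ (∀ n, g n ⊓ (u - c) = 0) ∧
      ∀ z, 0 ≤ z → z ≤ c → (∀ n, g n ⊓ z = 0) → z = 0 := by
  obtain ⟨hB, hdec⟩ := hE (Set.range g) (Set.countable_range g)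
  obtain ⟨c, z, hc, hz, rfl⟩ := hdec u
  have hc0 : 0 ≤ c := nonneg_of_add_nonneg_of_disjoint hu (hz c hc)
  have hz0 : 0 ≤ z := nonneg_of_add_nonneg_of_disjoint (by rwa [add_comm])
    (by rw [inf_comm]; exact hz c hc)
  refine ⟨c, hc0, le_add_of_nonneg_right hz0, fun n => ?_, fun y hy hyc hyg => ?_⟩
  · have := hz _ (subset_generatedBand _ ⟨n, rfl⟩)
    rwa [abs_of_nonneg hz0, abs_of_nonneg (hg n), inf_comm, ← add_sub_cancel_left c z] at this
  · refine eq_zero_of_mem_generatedBand_of_disjoint hy (hB.solid ?_ hc) ?_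
    · rwa [abs_of_nonneg hy, abs_of_nonneg hc0]
    · rintro _ ⟨n, rfl⟩
      rw [abs_of_nonneg (hg n), hyg n]

end LatticeOrderedGroup

/-! ### Order density of $X$ and the Archimedean property in the completion. -/

namespace OrderCompletion

variable {X : Type*} [AddCommGroup X] [Lattice X] [IsOrderedAddMonoid X]
  [IsArchimedeanVectorLattice X]

/-- The canonical embedding as a homomorphism of groups. -/
def ofHom : X →+ OrderCompletion X where
  toFun := of
  map_zero' := rfl
  map_add' := of_add

theorem of_sub (x y : X) : of (x - y) = of x - of y := map_sub ofHom x y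

theorem of_nsmul (n : ℕ) (x : X) : of (n • x) = n • of x := map_nsmul ofHom n x

theorem of_sum (s : Finset ℕ) (f : ℕ → X) : of (∑ i ∈ s, f i) = ∑ i ∈ s, of (f i) :=
  map_sum ofHom f s

/-- Order density in the form used below: an inequality in the completion can be tested on positive
elements of $X$, where components are available. -/
theorem nonpos_of_forall_of_le {A : OrderCompletion X}
    (h : ∀ x : X, 0 ≤ x → of x ≤ A ⊔ 0 → x = 0) : A ≤ 0 := by
  refine le_sup_left.trans ((isLUB_le_iff (isLUB_of (A ⊔ 0))).2 ?_)
  rintro _ ⟨x, hx, rfl⟩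
  have hx : of x ≤ A ⊔ 0 := hx
  have h0 := h (x ⊔ 0) le_sup_right (by rw [of_sup]; exact sup_le hx le_sup_right)
  exact of_le_of.2 (sup_eq_right.1 h0)

variable [Module ℝ X] [IsOrderedModule ℝ X]

/-- Since $X$ is majorizing, $e$ may be replaced by an element of $X$; the Archimedean property of
$X$ then applies to each $x\in X$ below $A$. -/
theorem nonpos_of_forall_le_smul {A e : OrderCompletion X} (h : ∀ ε : ℝ, 0 < ε → A ≤ ε • e) :
    A ≤ 0 := by
  obtain ⟨u, hu⟩ := exists_le_of e
  refine (isLUB_le_iff (isLUB_of A)).2 ?_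
  rintro _ ⟨x, hx, rfl⟩
  have hx : of x ≤ A := hx
  refine of_le_of.2 (IsArchimedeanVectorLattice.nonpos_of_forall_nsmul_le x (u ⊔ 0) fun n => ?_)
  have hn : (0 : ℝ) < (n : ℝ) + 1 := by positivity
  have h1 : x ≤ ((n : ℝ) + 1)⁻¹ • u := of_le_of.1 (by
    rw [of_smul]
    exact (hx.trans (h _ (inv_pos.2 hn))).trans (smul_le_smul_of_nonneg_left hu (by positivity)))
  rw [le_inv_smul_iff_of_pos hn] at h1
  rw [← Nat.cast_smul_eq_nsmul ℝ]
  have h2 : (n : ℝ) • x ≤ (n : ℝ) • (x ⊔ 0) := smul_le_smul_of_nonneg_left le_sup_left (by positivity)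
  have h3 : (n : ℝ) • (x ⊔ 0) ≤ ((n : ℝ) + 1) • (x ⊔ 0) :=
    smul_le_smul_of_nonneg_right (by linarith) le_sup_right
  have h4 : ((n : ℝ) + 1) • (x ⊔ 0) ≤ u ⊔ 0 := by
    rw [← le_inv_smul_iff_of_pos hn]
    refine sup_le (((le_inv_smul_iff_of_pos hn).2 h1).trans ?_) ?_
    · exact smul_le_smul_of_nonneg_left le_sup_left (by positivity)
    · exact smul_nonneg (by positivity) le_sup_right
  exact h2.trans (h3.trans h4)

theorem le_of_forall_le_add_smul {A B e : OrderCompletion X}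
    (h : ∀ ε : ℝ, 0 < ε → A ≤ B + ε • e) : A ≤ B :=
  sub_nonpos.1 (nonpos_of_forall_le_smul fun ε hε => sub_le_iff_le_add'.2 (h ε hε))

/-! ### Uniform limits as suprema of sequences. -/

theorem exists_of_regulator {x : ℕ → OrderCompletion X} {a : OrderCompletion X}
    (h : ConvergesUniformly x a) : ∃ u : X, 0 ≤ u ∧ ConvergesUniformlyRel (of u) x a := by
  obtain ⟨e, he, h⟩ := h
  obtain ⟨u, hu⟩ := exists_le_of e
  refine ⟨u, of_le_of.1 (he.trans hu), fun ε hε => ?_⟩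
  obtain ⟨N, hN⟩ := h ε hε
  exact ⟨N, fun n hn => (hN n hn).trans (smul_le_smul_of_nonneg_left hu hε.le)⟩

/-- A uniform limit is the supremum of the approximating sequence, shifted down by the errors. -/
theorem exists_isLUB_of_convergesUniformly {x : ℕ → OrderCompletion X} {a : OrderCompletion X}
    (h : ConvergesUniformly x a) :
    ∃ (u : X) (i : ℕ → ℕ), 0 ≤ u ∧
      (∀ n : ℕ, |x (i n) - a| ≤ ((n : ℝ) + 1)⁻¹ • of u) ∧
      ∀ b, (∀ n : ℕ, x (i n) - ((n : ℝ) + 1)⁻¹ • of u ≤ b) ↔ a ≤ b := by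
  obtain ⟨u, hu, h⟩ := exists_of_regulator h
  have hpos : ∀ n : ℕ, (0 : ℝ) < ((n : ℝ) + 1)⁻¹ := fun n => by positivity
  choose i hi using fun n : ℕ => h _ (hpos n)
  refine ⟨u, i, hu, fun n => hi n _ le_rfl, fun b => ⟨fun hb => ?_, fun hab n => ?_⟩⟩
  · refine le_of_forall_le_add_smul (e := of u) fun ε hε => ?_
    -- Half of $\varepsilon$, because two errors add up: $a\le x_{i_n}+u/(n+1)\le b+2u/(n+1)$.
    obtain ⟨n, hn⟩ := exists_nat_one_div_lt (half_pos hε)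
    have h1 := sub_le_iff_le_add'.1 ((neg_sub (x (i n)) a ▸ neg_le_abs _).trans (hi n _ le_rfl))
    refine h1.trans ?_
    have h2 := sub_le_iff_le_add.1 (hb n)
    have h3 : ((n : ℝ) + 1)⁻¹ • of u ≤ (ε / 2) • of u :=
      smul_le_smul_of_nonneg_right (by rw [← one_div]; exact hn.le) (of_le_of.2 hu)
    refine (add_le_add_left h2 _).trans ?_
    rw [add_assoc]
    refine (add_le_add_right (add_le_add h3 h3) _).trans ?_
    rw [← add_smul, add_halves]
  · have h1 := (le_abs_self _).trans (hi n _ le_rfl)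
    exact (sub_le_comm.1 h1).trans hab

theorem exists_seq_of_mem_uniformAdherence {a : OrderCompletion X}
    (ha : a ∈ uniformAdherence (Set.range (of : X → OrderCompletion X))) :
    ∃ y : ℕ → X, ∀ b, (∀ n, of (y n) ≤ b) ↔ a ≤ b := by
  obtain ⟨x, hx, h⟩ := ha
  choose z hz using hx
  obtain ⟨u, i, -, -, h⟩ := exists_isLUB_of_convergesUniformly h
  refine ⟨fun n => z (i n) - ((n : ℝ) + 1)⁻¹ • u, fun b => ?_⟩
  rw [← h b]
  simp only [of_sub, of_smul, hz]

/-- A countably order complete sublattice containing `X` is uniformly closed. -/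
theorem isUniformlyClosed_of_isCountablyOrderComplete {Z : Set (OrderCompletion X)}
    (hZ : IsVectorSublattice Z) (hc : IsCountablyOrderComplete Z)
    (hX : Set.range (of : X → OrderCompletion X) ⊆ Z) : IsUniformlyClosed Z := by
  intro x a hx h
  obtain ⟨u, i, hu, hi, hlub⟩ := exists_isLUB_of_convergesUniformly h
  have hmem : ∀ (r : ℝ) (n : ℕ), x n + r • of u ∈ Z := fun r n =>
    hZ.add_mem (hx n) (hZ.smul_mem r (hX ⟨u, rfl⟩))
  let y : ℕ → Z := fun n => ⟨x (i n) + (-((n : ℝ) + 1)⁻¹) • of u, hmem _ _⟩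
  have hy : ∀ n, (y n : OrderCompletion X) = x (i n) - ((n : ℝ) + 1)⁻¹ • of u := fun n => by
    simp only [y, neg_smul, sub_eq_add_neg]
  have hub : ∀ m : ℕ, a ≤ x (i m) + ((m : ℝ) + 1)⁻¹ • of u := fun m =>
    sub_le_iff_le_add'.1 ((neg_sub (x (i m)) a ▸ neg_le_abs _).trans (hi m))
  -- The supremum $z$ supplied by the hypothesis is taken in $Z$, so it could exceed the supremum
  -- $a$ taken in the completion. The elements $x_{i_m}+u/(m+1)$ lie in $Z$ and are upper bounds, so
  -- they dominate $z$, and they tend to $a$.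
  have hbound : ∀ m : ℕ, (⟨x (i m) + ((m : ℝ) + 1)⁻¹ • of u, hmem _ _⟩ : Z) ∈
      upperBounds (Set.range y) := by
    rintro m _ ⟨n, rfl⟩
    refine Subtype.coe_le_coe.1 ?_
    rw [hy]
    exact (hlub a).2 le_rfl n |>.trans (hub m)
  obtain ⟨z, hz⟩ := hc (Set.range y) (Set.countable_range y) (Set.range_nonempty y)
    ⟨_, hbound 0⟩
  have haz : a ≤ z := (hlub z).1 fun n => by
    rw [← hy]
    exact Subtype.coe_le_coe.2 (hz.1 ⟨n, rfl⟩)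
  have hza : (z : OrderCompletion X) ≤ a := by
    refine le_of_forall_le_add_smul (e := of u) fun ε hε => ?_
    obtain ⟨n, hn⟩ := exists_nat_one_div_lt (half_pos hε)
    have h1 : (z : OrderCompletion X) ≤ x (i n) + ((n : ℝ) + 1)⁻¹ • of u :=
      Subtype.coe_le_coe.2 (hz.2 (hbound n))
    have h2 := sub_le_iff_le_add'.1 ((le_abs_self _).trans (hi n))
    have h3 : ((n : ℝ) + 1)⁻¹ • of u ≤ (ε / 2) • of u :=
      smul_le_smul_of_nonneg_right (by rw [← one_div]; exact hn.le) (of_le_of.2 hu)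
    refine (h1.trans (add_le_add_left h2 _)).trans ?_
    rw [add_assoc]
    refine (add_le_add_right (add_le_add h3 h3) _).trans ?_
    rw [← add_smul, add_halves]
  exact le_antisymm haz hza ▸ z.2

/-! ### Vector and lattice operations on the uniform adherence. -/

theorem isVectorSublattice_uniformAdherence :
    IsVectorSublattice (uniformAdherence (Set.range (of : X → OrderCompletion X))) := by
  -- Addition, supremum and infimum are treated together: each preserves $X$ and is 1-Lipschitz in
  -- each variable, so the sum of the two regulators is a regulator for the result.
  have hbin : ∀ (f : X → X → X) (F : OrderCompletion X → OrderCompletion X → OrderCompletion X),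
      (∀ x y, of (f x y) = F (of x) (of y)) →
      (∀ a b c d, |F a b - F c d| ≤ |a - c| + |b - d|) →
      ∀ ⦃a b⦄, a ∈ uniformAdherence (Set.range (of : X → OrderCompletion X)) →
        b ∈ uniformAdherence (Set.range (of : X → OrderCompletion X)) →
        F a b ∈ uniformAdherence (Set.range (of : X → OrderCompletion X)) := by
    rintro f F hfF hF a b ⟨x, hx, e, he, hxa⟩ ⟨y, hy, e', he', hyb⟩
    refine ⟨fun n => F (x n) (y n), fun n => ?_, e + e', add_nonneg he he', fun ε hε => ?_⟩
    · obtain ⟨p, hp⟩ := hx n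
      obtain ⟨q, hq⟩ := hy n
      exact ⟨f p q, by rw [hfF, hp, hq]⟩
    · obtain ⟨N, hN⟩ := hxa ε hε
      obtain ⟨M, hM⟩ := hyb ε hε
      refine ⟨max N M, fun n hn => (hF _ _ _ _).trans ?_⟩
      rw [smul_add]
      exact add_le_add (hN n (le_of_max_le_left hn)) (hM n (le_of_max_le_right hn))
  refine ⟨?_, hbin (· + ·) (· + ·) of_add fun a b c d => ?_, ?_,
    hbin (· ⊔ ·) (· ⊔ ·) of_sup fun a b c d => ?_, hbin (· ⊓ ·) (· ⊓ ·) of_inf fun a b c d => ?_⟩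
  · exact ⟨fun _ => 0, fun _ => ⟨0, rfl⟩, 0, le_rfl, fun ε _ => ⟨0, fun n _ => by simp⟩⟩
  · rw [add_sub_add_comm]
    exact abs_add_le _ _
  · rintro r a ⟨x, hx, e, he, hxa⟩
    refine ⟨fun n => r • x n, fun n => ?_, |r| • e, smul_nonneg (abs_nonneg r) he,
      fun ε hε => ?_⟩
    · obtain ⟨p, hp⟩ := hx n
      exact ⟨r • p, by rw [of_smul, hp]⟩
    · obtain ⟨N, hN⟩ := hxa ε hε
      refine ⟨N, fun n hn => ?_⟩
      rw [← smul_sub, smul_comm]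
      exact (abs_smul_le_smul_abs _ _).trans
        (smul_le_smul_of_nonneg_left (hN n hn) (abs_nonneg r))
  · rw [← sub_add_sub_cancel _ (c ⊔ b) _, sup_comm c b, sup_comm c d]
    refine (abs_add_le _ _).trans (add_le_add ?_ (abs_sup_sub_sup_le_abs _ _ _))
    rw [sup_comm b c]
    exact abs_sup_sub_sup_le_abs _ _ _
  · rw [← sub_add_sub_cancel _ (c ⊓ b) _, inf_comm c b, inf_comm c d]
    refine (abs_add_le _ _).trans (add_le_add ?_ (abs_inf_sub_inf_le_abs _ _ _))
    rw [inf_comm b c]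
    exact abs_inf_sub_inf_le_abs _ _ _

theorem subset_uniformAdherence (A : Set (OrderCompletion X)) : A ⊆ uniformAdherence A :=
  fun a ha => ⟨fun _ => a, fun _ => ha, 0, le_rfl, fun ε _ => ⟨0, fun n _ => by simp⟩⟩

/-! ### Freudenthal-type approximation of countable suprema. -/

theorem exists_approx_of_isLUB (hX : HasSigmaPP X) {x : ℕ → X} {u : X} (hx : ∀ n, 0 ≤ x n)
    {s : OrderCompletion X} (hs : IsLUB (Set.range fun n => of (x n)) s) (hsu : s ≤ of u)
    (m : ℕ) : ∃ y : X, |of y - s| ≤ ((m : ℝ) + 1)⁻¹ • of u := by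
  have hxs : ∀ n, of (x n) ≤ s := fun n => hs.1 ⟨n, rfl⟩
  have hs0 : 0 ≤ s := (of_le_of.2 (hx 0)).trans (hxs 0)
  have hu : 0 ≤ u := of_le_of.1 (hs0.trans hsu)
  have hm : (0 : ℝ) < ((m : ℝ) + 1)⁻¹ := by positivity
  set t : ℝ := ((m : ℝ) + 1)⁻¹ with ht
  set h : X := t • u with hh
  have hh0 : 0 ≤ h := smul_nonneg hm.le hu
  have huh : (m + 1) • h = u := by
    rw [← Nat.cast_smul_eq_nsmul ℝ, hh, smul_smul, ht]
    push_cast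
    rw [mul_inv_cancel₀ (by positivity), one_smul]
  have hhu : h ≤ u := by
    rw [← huh, succ_nsmul]
    exact le_add_of_nonneg_left (nsmul_nonneg hh0 _)
  -- Level $j+1$ rather than $j$: the spare height $h$ makes layer $j$ of $s$ full on the band where
  -- some $x_n$ exceeds $(j+1)h$.
  have hcomp := fun j : ℕ => hX.exists_component
    (g := fun n => (x n - (j + 1) • h) ⊔ 0) (fun n => le_sup_right) hu
  choose c hc0 hcu hcd hcz using hcomp
  have htle : t ≤ 1 := inv_le_one_of_one_le₀ (by linarith [m.cast_nonneg (α := ℝ)])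
  have hle_self : ∀ y : X, 0 ≤ y → t • y ≤ y := fun y hy => by
    simpa using smul_le_smul_of_nonneg_right htle hy
  have hupper : ∀ n, x n ≤ h + ∑ j ∈ Finset.range m, t • c j := fun n => by
    have hxn : x n ≤ u := of_le_of.1 ((hxs n).trans hsu)
    rw [← inf_eq_left.2 hxn]
    nth_rw 1 [← huh]
    refine inf_nsmul_le_add_sum hh0 (fun j => ?_) m
    have hsplit : h = t • c j + t • (u - c j) := by rw [← smul_add, add_sub_cancel]
    have h1 : 0 ≤ t • c j := smul_nonneg hm.le (hc0 j)
    have h2 : 0 ≤ u - c j := sub_nonneg.2 (hcu j)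
    -- Only the part of $h$ inside the band contributes: $t(u-c_j)\le u-c_j$ is disjoint from every
    -- generator.
    have h3 : ((x n - (j + 1) • h) ⊔ 0) ⊓ t • (u - c j) = 0 :=
      inf_eq_zero_of_le le_sup_right (smul_nonneg hm.le h2) le_rfl (hle_self _ h2) (hcd j n)
    calc ((x n - (j + 1) • h) ⊔ 0) ⊓ h
        ≤ ((x n - (j + 1) • h) ⊔ 0) ⊓ t • c j + ((x n - (j + 1) • h) ⊔ 0) ⊓ t • (u - c j) := by
          nth_rw 2 [hsplit]
          exact inf_add_le_inf_add_inf le_sup_right h1 (smul_nonneg hm.le h2)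
      _ ≤ t • c j := by rw [h3, add_zero]; exact inf_le_right
  have hlower : of (∑ j ∈ Finset.range m, t • c j) ≤ s := by
    rw [of_sum]
    refine (sum_le_inf_nsmul hs0 (of_le_of.2 hh0) (d := fun j => of (t • c j))
      (fun j => le_inf ?_ (of_le_of.2 (smul_le_smul_of_nonneg_left (hcu j) hm.le))) m).trans
      inf_le_left
    set w := s - j • of h with hw
    -- Let $0\le z\in X$ lie below $(t\,c_j-w^+)^+$. Then $z\le c_j$, and $z\le(h-w)^+$ because
    -- $t\,c_j\le h$. Each generator lies below $(w-h)^+$, so $z$ is disjoint from all of them and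
    -- must vanish.
    refine sub_nonpos.1 (nonpos_of_forall_of_le fun z hz0 hz => ?_)
    refine hcz j z hz0 ?_ fun n => ?_
    · refine of_le_of.1 (hz.trans ?_)
      refine sup_le ((sub_le_self _ le_sup_right).trans (of_le_of.2 (hle_self _ (hc0 j)))) ?_
      exact of_le_of.2 (hc0 j)
    · have key : of ((x n - (j + 1) • h) ⊔ 0) ⊓ of z = 0 := by
        refine inf_eq_zero_of_le (of_le_of.2 le_sup_right) (of_le_of.2 hz0) ?_ ?_
          (sup_zero_inf_neg_sup_zero (w - of h))
        · rw [of_sup, of_sub, of_nsmul, succ_nsmul, hw, sub_sub]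
          exact sup_le_sup_right (sub_le_sub_right (hxs n) _) _
        · refine hz.trans (sup_le_sup_right ?_ 0)
          rw [neg_sub]
          exact sub_le_sub (of_le_of.2 (smul_le_smul_of_nonneg_left (hcu j) hm.le)) le_sup_left
      rw [← of_inf] at key
      exact le_antisymm (of_le_of.1 key.le) (of_le_of.1 key.ge)
  refine ⟨∑ j ∈ Finset.range m, t • c j, ?_⟩
  rw [← of_smul]
  refine abs_le'.2 ⟨(sub_nonpos.2 hlower).trans (of_le_of.2 hh0), ?_⟩
  rw [neg_sub, sub_le_iff_le_add, ← of_add]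
  refine hs.2 ?_
  rintro _ ⟨n, rfl⟩
  exact of_le_of.2 (hupper n)

theorem mem_uniformAdherence_of_isLUB (hX : HasSigmaPP X) {x : ℕ → X} {s : OrderCompletion X}
    (hs : ∀ b, (∀ n, of (x n) ≤ b) ↔ s ≤ b) :
    s ∈ uniformAdherence (Set.range (of : X → OrderCompletion X)) := by
  obtain ⟨u, hu⟩ := exists_le_of s
  -- Translation by $x_0$ followed by positive parts gives a positive sequence. Positive parts do
  -- not change the supremum, since $s-x_0\ge 0$ is already the supremum of the $x_n-x_0$.
  have hlub : IsLUB (Set.range fun n => of ((x n - x 0) ⊔ 0)) (s - of (x 0)) := by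
    refine ⟨?_, fun b hb => ?_⟩
    · rintro _ ⟨n, rfl⟩
      dsimp only
      rw [of_sup, of_sub]
      exact sup_le (sub_le_sub_right ((hs s).2 le_rfl n) _) (sub_nonneg.2 ((hs s).2 le_rfl 0))
    · refine sub_le_iff_le_add.2 ((hs _).1 fun n => sub_le_iff_le_add.1 ?_)
      rw [← of_sub]
      exact (of_le_of.2 le_sup_left).trans (hb ⟨n, rfl⟩)
  have hsu : s - of (x 0) ≤ of (u - x 0) := by
    rw [of_sub]
    exact sub_le_sub_right hu _
  choose y hy using exists_approx_of_isLUB hX (fun n => le_sup_right) hlub hsu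
  have h0 : 0 ≤ of (u - x 0) := (sub_nonneg.2 ((hs s).2 le_rfl 0)).trans hsu
  refine ⟨fun m => of (y m + x 0), fun m => ⟨_, rfl⟩, of (u - x 0), h0, fun ε hε => ?_⟩
  obtain ⟨N, hN⟩ := exists_nat_one_div_lt hε
  refine ⟨N, fun m hm => ?_⟩
  have : of (y m + x 0) - s = of (y m) - (s - of (x 0)) := by rw [of_add]; abel
  rw [this]
  refine (hy m).trans (smul_le_smul_of_nonneg_right (le_trans ?_ hN.le) h0)
  rw [← one_div]
  exact one_div_le_one_div_of_le (by positivity) (by exact_mod_cast Nat.succ_le_succ hm)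

theorem isCountablyOrderComplete_uniformAdherence (hX : HasSigmaPP X) :
    IsCountablyOrderComplete (uniformAdherence (Set.range (of : X → OrderCompletion X))) := by
  intro S hS hne hb
  obtain ⟨y, rfl⟩ := hS.exists_eq_range hne
  choose x hx using fun n => exists_seq_of_mem_uniformAdherence (y n).2
  obtain ⟨b, hb⟩ := hb
  -- The supremum is formed in the whole completion. Once it is known to lie in the adherence, it is
  -- also the supremum there.
  obtain ⟨s, hs⟩ := exists_isLUB (Set.range fun n => (y n : OrderCompletion X))
    (Set.range_nonempty _) ⟨b, by
      rintro _ ⟨n, rfl⟩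
      exact Subtype.coe_le_coe.2 (hb ⟨n, rfl⟩)⟩
  have hmem : s ∈ uniformAdherence (Set.range (of : X → OrderCompletion X)) := by
    -- The sequences in $X$ whose suprema are the individual $y_n$ are merged into one by the
    -- pairing function.
    refine mem_uniformAdherence_of_isLUB hX
      (x := fun k => x (Nat.unpair k).1 (Nat.unpair k).2) fun b => ?_
    rw [isLUB_le_iff hs]
    constructor
    · rintro h _ ⟨n, rfl⟩
      refine (hx n b).1 fun m => ?_
      simpa using h (Nat.pair n m)
    · exact fun h k => (hx _ b).2 (h ⟨_, rfl⟩) _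
  refine ⟨⟨s, hmem⟩, ?_, fun c hc => ?_⟩
  · rintro _ ⟨n, rfl⟩
    exact Subtype.coe_le_coe.1 (hs.1 ⟨n, rfl⟩)
  · refine Subtype.coe_le_coe.1 (hs.2 ?_)
    rintro _ ⟨n, rfl⟩
    exact Subtype.coe_le_coe.2 (hc ⟨n, rfl⟩)

end OrderCompletion

/-- The order completion of `X` is `OrderCompletion X`, and `X` is identified with its image
`Set.range of` in it. -/
theorem mainTheorem7 {X : Type*} [AddCommGroup X] [Lattice X] [IsOrderedAddMonoid X]
    [Module ℝ X] [IsOrderedModule ℝ X] [IsArchimedeanVectorLattice X] (hX : HasSigmaPP X) :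
    uniformAdherence (Set.range (OrderCompletion.of : X → OrderCompletion X)) =
        uniformClosure (Set.range (OrderCompletion.of : X → OrderCompletion X)) ∧
      IsLeast {Y : Set (OrderCompletion X) | IsVectorSublattice Y ∧
          IsCountablyOrderComplete Y ∧ Set.range (OrderCompletion.of : X → OrderCompletion X) ⊆ Y}
        (uniformAdherence (Set.range (OrderCompletion.of : X → OrderCompletion X))) := by
  have hsub := OrderCompletion.isVectorSublattice_uniformAdherence (X := X)
  have hcoc := OrderCompletion.isCountablyOrderComplete_uniformAdherence hX
  have hX' := OrderCompletion.subset_uniformAdherence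
    (Set.range (OrderCompletion.of : X → OrderCompletion X))
  refine ⟨Set.Subset.antisymm ?_ ?_, ⟨hsub, hcoc, hX'⟩, ?_⟩
  · rintro a ⟨x, hx, h⟩ C ⟨hC, hXC⟩
    exact hC x a (fun n => hXC (hx n)) h
  -- The adherence is one of the uniformly closed sets being intersected, so a single passage to
  -- limits already yields the closure.
  · exact Set.sInter_subset_of_mem
      ⟨OrderCompletion.isUniformlyClosed_of_isCountablyOrderComplete hsub hcoc hX', hX'⟩
  · rintro Z ⟨hZ, hZc, hXZ⟩ a ⟨x, hx, h⟩
    exact OrderCompletion.isUniformlyClosed_of_isCountablyOrderComplete hZ hZc hXZ x a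
      (fun n => hXZ (hx n)) h
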